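/- Let $\mathcal H$ (system) and $\mathcal M$ (memory) be finite-dimensional Hilbert spaces, let $U:\mathcal M\otimes\mathcal H\to\mathcal H\otimes\mathcal M$ be unitary, write $\mathcal U(\tau)=U\tau U^\dagger$, and let $\xi$ be a state (density operator) of the memory. Let $X$ be a finite set of settings; a setting $x\in X$ consists of a test state $\varrho_x$ on $\mathcal H$ and a measurement $M_x$ given by finitely many effects $E_{xk}\ge 0$ with $\sum_k E_{xk}=I$. Let $q_x>0$ with $\sum_x q_x=1$. The device $(\mathcal U,\xi)$ is used repeatedly. In the $j$th run ($j=1,2,\dots$) the setting $x$ is selected with probability $q_x$, independently of everything that happened before. If $\xi_j$ is the state of the memory before this run ($\xi_1=\xi$) and $x$ is selected, then the outcome $k$ is recorded with probability $\mathrm{tr}\,\mathcal I_{xk}[\xi_j]$, where $\mathcal I_{xk}[\eta]=\mathrm{tr}_{\mathcal H}[\mathcal U(\eta\otimes\varrho_x)(E_{xk}\otimes I_{\mathcal M})]$, and the memory is then in the state $\xi_{j+1}=\mathcal I_{xk}[\xi_j]/\mathrm{tr}\,\mathcal I_{xk}[\xi_j]$. Let $N_x$ be the number of the first $n$ runs in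 which the setting $x$ was selected, and $N_{xk}$ the number of those in which, in addition, the outcome $k$ was recorded. Then with probability one there is a state $\overline\xi$ of the memory (which may depend on the observed realization of the experiment, but not on $x$) such that: 1. $\overline\xi$ is the average memory state, whichever setting is used: as $n\to\infty$, $\frac1n\sum_{j\le n}\xi_j\to\overline\xi$, and for every setting $x$ the average of $\xi_j$ over those $j\le n$ for which $x$ was selected in the $j$th run converges to $\overline\xi$ too; 2. for every setting $x$ and every outcome $k$ of $M_x$, $$\lim_{n\to\infty}\frac{N_{xk}}{N_x}=p(k|x):=\mathrm{tr}\big[\mathcal U(\overline\xi\otimes\varrho_x)(E_{xk}\otimes I_{\mathcal M})\big];$$ 3. the average map $\mathcal E(\varrho)=\mathrm{tr}_{\mathcal M}[\mathcal U(\overline\xi\otimes\varrho)]$ is a quantum channel (completely positive and trace preserving), $p(k|x)=\mathrm{tr}[E_{xk}\mathcal E(\varrho_x)]$ for all $x,k$, and quantum process tomography reconstructs $\mathcal E$: if $R$ is any map from real tables $(t(k|x))_{x,k}$ to linear maps on operators on $\mathcal H$ that sends the table $(\mathrm{tr}[E_{xk}\mathcal F(\varrho_x)])_{x,k}$ to $\mathcal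 F$ for every channel $\mathcal F$ on $\mathcal H$, then $R(p)=\mathcal E$; and if moreover $R$ is continuous at $p$, then the reconstructions $R\big((N_{xk}/N_x)_{x,k}\big)$ converge to $\mathcal E$ as $n\to\infty$. -/

import Mathlib

open Filter Topology MeasureTheory
open scoped Kronecker Matrix ComplexOrder

namespace MemoryQPT

noncomputable section

/-- Density matrices: positive semidefinite matrices of unit trace. -/
def IsState {d : Type*} [Fintype d] (ρ : Matrix d d ℂ) : Prop :=
  ρ.PosSemidef ∧ ρ.trace = 1

/-- Unitary maps from memory ⊗ system to system ⊗ memory (the output factors are listed in the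
opposite order). -/
def IsUnitary {H M : Type*} [Fintype H] [Fintype M] [DecidableEq H] [DecidableEq M]
    (U : Matrix (H × M) (M × H) ℂ) : Prop :=
  Uᴴ * U = 1 ∧ U * Uᴴ = 1

/-- The state of system ⊗ memory after one use of the device on memory state `ξ` and input `ρ`:
`U (ξ ⊗ ρ) U†`. -/
def interact {H M : Type*} [Fintype H] [Fintype M]
    (U : Matrix (H × M) (M × H) ℂ) (ξ : Matrix M M ℂ) (ρ : Matrix H H ℂ) :
    Matrix (H × M) (H × M) ℂ :=
  U * (ξ ⊗ₖ ρ) * Uᴴ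

/-- Partial trace over the memory. -/
def traceMemory {H M : Type*} [Fintype M] (τ : Matrix (H × M) (H × M) ℂ) : Matrix H H ℂ :=
  Matrix.of fun a b => ∑ m, τ (a, m) (b, m)

/-- Partial trace over the system. -/
def traceSystem {H M : Type*} [Fintype H] (τ : Matrix (H × M) (H × M) ℂ) : Matrix M M ℂ :=
  Matrix.of fun m m' => ∑ a, τ (a, m) (a, m')

/-- The map `ρ ↦ tr_M [U (ξ ⊗ ρ) U†]` on the system. -/
def inducedMap {H M : Type*} [Fintype H] [Fintype M]
    (U : Matrix (H × M) (M × H) ℂ) (ξ : Matrix M M ℂ) :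
    Matrix H H ℂ →ₗ[ℂ] Matrix H H ℂ where
  toFun ρ := traceMemory (interact U ξ ρ)
  map_add' ρ σ := by
    ext a b
    simp [traceMemory, interact, Matrix.kronecker_add, Matrix.mul_add, Matrix.add_mul,
      Finset.sum_add_distrib]
  map_smul' c ρ := by
    ext a b
    simp [traceMemory, interact, Matrix.kronecker_smul, Finset.mul_sum]

/-- The ampliation `F ⊗ id` of a linear map on matrices by an `n`-dimensional ancilla. -/
def ampliation {H : Type*} (F : Matrix H H ℂ →ₗ[ℂ] Matrix H H ℂ) (n : ℕ)
    (τ : Matrix (H × Fin n) (H × Fin n) ℂ) : Matrix (H × Fin n) (H × Fin n) ℂ :=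
  Matrix.of fun p p' => F (Matrix.of fun a b => τ (a, p.2) (b, p'.2)) p.1 p'.1

/-- Quantum channels: completely positive trace-preserving linear maps. -/
def IsChannel {H : Type*} [Fintype H] (F : Matrix H H ℂ →ₗ[ℂ] Matrix H H ℂ) : Prop :=
  (∀ (n : ℕ) (τ : Matrix (H × Fin n) (H × Fin n) ℂ),
    τ.PosSemidef → (ampliation F n τ).PosSemidef) ∧
  ∀ ρ : Matrix H H ℂ, (F ρ).trace = ρ.trace

/-- Finitely many settings `x = (ρ x, M_x)`, where `M_x` is the POVM with effects `E x k`; the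
setting `x` is selected with probability `q x > 0`. -/
structure Scheme (X : Type*) (K : X → Type*) (H : Type*) [Fintype X] [∀ x, Fintype (K x)]
    [Fintype H] [DecidableEq H] where
  q : X → ℝ
  q_pos : ∀ x, 0 < q x
  q_sum : ∑ x, q x = 1
  ρ : X → Matrix H H ℂ
  ρ_state : ∀ x, IsState (ρ x)
  E : ∀ x, K x → Matrix H H ℂ
  E_pos : ∀ x k, (E x k).PosSemidef
  E_sum : ∀ x, ∑ k, E x k = 1

section Run

variable {X : Type*} {K : X → Type*} {H M : Type*} [Fintype X] [∀ x, Fintype (K x)]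
  [Fintype H] [DecidableEq H] [Fintype M] [DecidableEq M]

/-- The unnormalised memory state after the event `e = ⟨x, k⟩` (setting `x`, outcome `k`):
`tr_H [U (ξ ⊗ ρ_x) U† (E_xk ⊗ I)]`. Its trace is the probability of `k` given `x`. -/
def instrument (Q : Scheme X K H) (U : Matrix (H × M) (M × H) ℂ) (e : Σ x, K x)
    (ξ : Matrix M M ℂ) : Matrix M M ℂ :=
  traceSystem (interact U ξ (Q.ρ e.1) * (Q.E e.1 e.2 ⊗ₖ (1 : Matrix M M ℂ)))

/-- The memory state before run `j` (runs are counted from `0`), given the initial memory state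
`ξ` and the recorded events `e 0, e 1, …`. -/
def memoryState (Q : Scheme X K H) (U : Matrix (H × M) (M × H) ℂ) (ξ : Matrix M M ℂ)
    (e : ℕ → Σ x, K x) : ℕ → Matrix M M ℂ
  | 0 => ξ
  | j + 1 =>
    (instrument Q U (e j) (memoryState Q U ξ e j)).trace⁻¹ •
      instrument Q U (e j) (memoryState Q U ξ e j)

/-- The probability of recording `e 0, …, e (n - 1)` in the first `n` runs: in run `j` the setting
`x` is selected with probability `q x` whatever happened before, and the outcome obeys the Born
rule. -/
def recordProb (Q : Scheme X K H) (U : Matrix (H × M) (M × H) ℂ) (ξ : Matrix M M ℂ)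
    (e : ℕ → Σ x, K x) (n : ℕ) : ℝ :=
  ∏ j ∈ Finset.range n,
    Q.q (e j).1 * (instrument Q U (e j) (memoryState Q U ξ e j)).trace.re

/-- `S j` is the random event recorded in run `j` of the experiment in which one and the same
device, given by `U` and the initial memory state `ξ`, is used over and over with randomly
selected settings. -/
structure IsRandomizedRun {Ω : Type*} [MeasurableSpace Ω] (μ : Measure Ω)
    (Q : Scheme X K H) (U : Matrix (H × M) (M × H) ℂ) (ξ : Matrix M M ℂ)
    (S : ℕ → Ω → Σ x, K x) : Prop where
  measurable : ∀ j e, MeasurableSet {ω | S j ω = e}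
  law : ∀ (n : ℕ) (e : ℕ → Σ x, K x),
    μ {ω | ∀ j < n, S j ω = e j} = ENNReal.ofReal (recordProb Q U ξ e n)

end Run

section Counts

variable {X : Type*} {K : X → Type*}

open Classical in
/-- The runs among the first `n` in which setting `x` was used. -/
def runsWith (e : ℕ → Σ x, K x) (x : X) (n : ℕ) : Finset ℕ :=
  (Finset.range n).filter fun j => (e j).1 = x

/-- `N_x`: the number of the first `n` runs with setting `x`. -/
def settingCount (e : ℕ → Σ x, K x) (x : X) (n : ℕ) : ℕ :=
  (runsWith e x n).card

open Classical in
/-- `N_xk`: the number of the first `n` runs with setting `x` and outcome `k`. -/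
def eventCount (e : ℕ → Σ x, K x) (x : X) (k : K x) (n : ℕ) : ℕ :=
  ((Finset.range n).filter fun j => e j = ⟨x, k⟩).card

/-- The observed table of conditional frequencies `N_xk / N_x` after `n` runs. -/
def frequency (e : ℕ → Σ x, K x) (n : ℕ) (x : X) (k : K x) : ℝ :=
  (eventCount e x k n : ℝ) / (settingCount e x n : ℝ)

end Counts

/-- `p x k` is, for all settings, the conditional probability of outcome `k` given setting `x` for
independent uses of the memoryless channel `F`. -/
def IsTableOf {X : Type*} {K : X → Type*} {H : Type*} [Fintype X] [∀ x, Fintype (K x)]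
    [Fintype H] [DecidableEq H] (Q : Scheme X K H) (F : Matrix H H ℂ →ₗ[ℂ] Matrix H H ℂ)
    (p : ∀ x, K x → ℝ) : Prop :=
  ∀ x k, (p x k : ℂ) = (Q.E x k * F (Q.ρ x)).trace

/-- A process tomography reconstruction: a processing of tables of conditional probabilities that
identifies every memoryless channel. -/
def IsReconstruction {X : Type*} {K : X → Type*} {H : Type*} [Fintype X] [∀ x, Fintype (K x)]
    [Fintype H] [DecidableEq H] (Q : Scheme X K H)
    (R : (∀ x, K x → ℝ) → (Matrix H H ℂ →ₗ[ℂ] Matrix H H ℂ)) : Prop :=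
  ∀ F, IsChannel F → ∀ p, IsTableOf Q F p → R p = F

end

end MemoryQPT

open MemoryQPT

/-! Given the record so far, the mean of the next memory state is `T ξ_j`, where `T` is
`averageMap`, a linear map that sends states to states. Its orbits of states are therefore bounded,
and the mean ergodic theorem in finite dimension (`exists_invariant_add_coboundary`) splits every
functional as `φ = φ₁ + (ψ ∘ T - ψ)` with `φ₁ ∘ T = φ₁`. Along the run `φ₁ ξ_j` is a bounded
martingale, so it converges almost surely; its limit may be random, which is why the average state
may depend on the realization. The coboundary `ψ (T ξ_j) - ψ ξ_j` is the telescoping term `ψ ξ_{j+1}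
- ψ ξ_j` minus the bounded martingale difference `ψ ξ_{j+1} - ψ (T ξ_j)`, so its averages vanish.
With matrix entries for `φ` this yields the average state (`IsRandomizedRun.ae_exists_average`).

Since the setting is selected independently of the past, `(1[x_j = x] - q_x) φ ξ_j` is a bounded
martingale difference, and so is the indicator of an event minus its Born weight. Both average to
zero by `HasCylinderLaw.ae_tendsto_average_zero`; linearity in the memory state then puts the
average state into the Born rule. The limiting table is thus exactly the table of the induced
channel.

Conditional means enter only as finite sums over the next letter, weighted by cylinder probabilities
(`HasCylinderLaw.integral_eq_zero_of_step`). -/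

namespace MemoryQPT

/-! ### Random letter sequences and martingales given by cylinder probabilities -/

section Letters

/-- `S` is a sequence of random letters whose first `n` letters are those of `e` with probability
`P e n`. -/
structure HasCylinderLaw {A Ω : Type*} [MeasurableSpace Ω] (μ : Measure Ω)
    (P : (ℕ → A) → ℕ → ℝ) (S : ℕ → Ω → A) : Prop where
  measurableSet : ∀ j a, MeasurableSet {ω | S j ω = a}
  nonneg : ∀ e n, 0 ≤ P e n
  dependsOn : ∀ n, DependsOn (fun e => P e n) (Set.Iio n)
  law : ∀ n e, μ {ω | ∀ j < n, S j ω = e j} = ENNReal.ofReal (P e n)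

/-- The letters of the word `w`, followed by the letter `a` forever. -/
def padWord {A : Type*} (a : A) {n : ℕ} (w : Fin n → A) (i : ℕ) : A :=
  if h : i < n then w ⟨i, h⟩ else a

theorem padWord_of_lt {A : Type*} (a : A) {n : ℕ} (w : Fin n → A) {i : ℕ} (h : i < n) :
    padWord a w i = w ⟨i, h⟩ := dif_pos h

theorem DependsOn.update_eq {A β : Type*} {f : (ℕ → A) → β} {n : ℕ}
    (hf : DependsOn f (Set.Iio n)) (e : ℕ → A) (a : A) :
    f (Function.update e n a) = f e :=
  hf fun _ hi => Function.update_of_ne (ne_of_lt hi) _ _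

variable {A Ω : Type*} {S : ℕ → Ω → A}

/-- The σ-algebra generated by the first `n` letters. -/
@[reducible]
def letterAlgebra (S : ℕ → Ω → A) (n : ℕ) : MeasurableSpace Ω :=
  MeasurableSpace.comap (fun ω (i : Fin n) => S i ω) ⊤

theorem exists_word_set {n : ℕ} {s : Set Ω} (hs : MeasurableSet[letterAlgebra S n] s) :
    ∃ t : Set (Fin n → A), (fun ω (i : Fin n) => S i ω) ⁻¹' t = s := by
  obtain ⟨t, -, ht⟩ := hs
  exact ⟨t, ht⟩

/-- No regularity of `f` is needed: it factors through the word of the first `n` letters, and the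
word space carries the discrete σ-algebra. -/
theorem measurable_letterAlgebra {β : Type*} [MeasurableSpace β] {f : (ℕ → A) → β} {n : ℕ}
    (hf : DependsOn f (Set.Iio n)) :
    Measurable[letterAlgebra S n] fun ω => f fun i => S i ω := by
  rcases isEmpty_or_nonempty Ω with hΩ | ⟨⟨ω₀⟩⟩
  · intro s _
    exact ⟨∅, trivial, Subsingleton.elim _ _⟩
  have : (fun ω => f fun i => S i ω) =
      (fun w => f (padWord (S 0 ω₀) w)) ∘ fun ω (i : Fin n) => S i ω := by
    funext ω
    exact hf fun i hi => by rw [padWord_of_lt _ _ hi]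
  rw [this]
  intro s _
  exact ⟨(fun w => f (padWord (S 0 ω₀) w)) ⁻¹' s, trivial, rfl⟩

namespace HasCylinderLaw

variable [Fintype A] [MeasurableSpace Ω] {μ : Measure Ω} {P : (ℕ → A) → ℕ → ℝ}
  (hS : HasCylinderLaw μ P S)
include hS

theorem measurable_word (n : ℕ) :
    Measurable[_, ⊤] fun ω (i : Fin n) => S i ω := by
  let _ : MeasurableSpace (Fin n → A) := ⊤
  refine measurable_to_countable' fun w => ?_
  have : (fun ω (i : Fin n) => S i ω) ⁻¹' {w} = ⋂ i : Fin n, {ω | S i ω = w i} := by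
    ext ω
    simp [funext_iff]
  rw [this]
  exact MeasurableSet.iInter fun i => hS.measurableSet _ _

theorem letterAlgebra_le (n : ℕ) : letterAlgebra S n ≤ ‹MeasurableSpace Ω› :=
  (hS.measurable_word n).comap_le

/-- The filtration of the letters. -/
def filtration : Filtration ℕ ‹MeasurableSpace Ω› where
  seq := letterAlgebra S
  mono' m n hmn := by
    rintro s ⟨t, -, rfl⟩
    exact ⟨(fun w (i : Fin m) => w (Fin.castLE hmn i)) ⁻¹' t, trivial, rfl⟩
  le' := hS.letterAlgebra_le

theorem measurable {β : Type*} [MeasurableSpace β] {f : (ℕ → A) → β} {n : ℕ}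
    (hf : DependsOn f (Set.Iio n)) : Measurable fun ω => f fun i => S i ω :=
  (measurable_letterAlgebra hf).mono (hS.letterAlgebra_le n) le_rfl

/-- There are only finitely many words of length `n`, so the function is bounded by the sum of its
absolute values over all of them. -/
theorem integrable [IsFiniteMeasure μ] {f : (ℕ → A) → ℝ} {n : ℕ}
    (hf : DependsOn f (Set.Iio n)) : Integrable (fun ω => f fun i => S i ω) μ := by
  classical
  rcases isEmpty_or_nonempty Ω with hΩ | ⟨⟨ω₀⟩⟩
  · exact Integrable.of_isEmpty
  refine Integrable.of_bound (hS.measurable hf).aestronglyMeasurable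
    (∑ w : Fin n → A, ‖f (padWord (S 0 ω₀) w)‖) (ae_of_all _ fun ω => ?_)
  have : f (fun i => S i ω) = f (padWord (S 0 ω₀) fun i : Fin n => S i ω) :=
    hf fun i hi => by rw [padWord_of_lt _ _ hi]
  rw [this]
  exact Finset.single_le_sum (f := fun w => ‖f (padWord (S 0 ω₀) w)‖)
    (fun _ _ => norm_nonneg _) (Finset.mem_univ _)

theorem integral_eq_sum [IsFiniteMeasure μ] (a : A) {f : (ℕ → A) → ℝ} {n : ℕ}
    (hf : DependsOn f (Set.Iio n)) :
    ∫ ω, f (fun i => S i ω) ∂μ = ∑ w : Fin n → A, P (padWord a w) n * f (padWord a w) := by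
  classical
  have hcyl : ∀ w : Fin n → A, {ω | ∀ j < n, S j ω = padWord a w j} =
      (fun ω (i : Fin n) => S i ω) ⁻¹' {w} := by
    intro w
    ext ω
    simp only [Set.mem_ofPred_eq, Set.mem_preimage, Set.mem_singleton_iff, funext_iff]
    exact ⟨fun h i => by rw [h i i.2, padWord_of_lt _ _ i.2],
      fun h j hj => by rw [padWord_of_lt _ _ hj, ← h ⟨j, hj⟩]⟩
  have hm : ∀ w : Fin n → A, MeasurableSet {ω | ∀ j < n, S j ω = padWord a w j} := fun w => by
    rw [hcyl]
    exact hS.measurable_word n trivial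
  have hdec : ∀ ω, f (fun i => S i ω) = ∑ w : Fin n → A,
      {ω | ∀ j < n, S j ω = padWord a w j}.indicator (fun _ => f (padWord a w)) ω := by
    intro ω
    rw [Finset.sum_eq_single fun i : Fin n => S i ω]
    · rw [Set.indicator_of_mem]
      · exact hf fun i hi => by rw [padWord_of_lt _ _ hi]
      · intro j hj
        rw [padWord_of_lt _ _ hj]
    · intro w _ hw
      rw [hcyl, Set.indicator_of_notMem]
      exact fun h => hw h.symm
    · simp
  simp_rw [hdec]
  rw [integral_finsetSum _ fun w _ => (integrable_const _).indicator (hm w)]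
  refine Finset.sum_congr rfl fun w _ => ?_
  rw [integral_indicator_const _ (hm w), Measure.real, hS.law,
    ENNReal.toReal_ofReal (hS.nonneg _ _), smul_eq_mul]

/-- Grouping the words of length `n + 1` by their first `n` letters makes each inner sum vanish.
This stands in for "conditional mean zero implies mean zero". -/
theorem integral_eq_zero_of_step [IsFiniteMeasure μ] {f : (ℕ → A) → ℝ} {n : ℕ}
    (hf : DependsOn f (Set.Iio (n + 1)))
    (h : ∀ e, ∑ a, P (Function.update e n a) (n + 1) * f (Function.update e n a) = 0) :
    ∫ ω, f (fun i => S i ω) ∂μ = 0 := by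
  rcases isEmpty_or_nonempty Ω with hΩ | ⟨⟨ω₀⟩⟩
  · simp [Measure.eq_zero_of_isEmpty μ]
  set a₀ := S 0 ω₀
  rw [hS.integral_eq_sum a₀ hf, ← Equiv.sum_comp (Fin.snocEquiv fun _ => A), Fintype.sum_prod_type,
    Finset.sum_comm]
  refine Finset.sum_eq_zero fun w _ => ?_
  rw [← h (padWord a₀ w)]
  refine Finset.sum_congr rfl fun a _ => ?_
  have key : ∀ i ∈ Set.Iio (n + 1), padWord a₀ (Fin.snocEquiv (fun _ => A) (a, w)) i =
      Function.update (padWord a₀ w) n a i := by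
    intro i hi
    rw [padWord_of_lt _ _ hi]
    rcases (Nat.lt_succ_iff_lt_or_eq.mp hi) with hlt | rfl
    · rw [Function.update_of_ne hlt.ne, padWord_of_lt _ _ hlt]
      exact Fin.snoc_castSucc (α := fun _ => A) a w ⟨i, hlt⟩
    · rw [Function.update_self]
      exact Fin.snoc_last (α := fun _ => A) a w
  exact congrArg₂ (· * ·) (hS.dependsOn _ key) (hf key)

/-- For each length the impossible words form a finite union of null cylinders. -/
theorem ae_ne_zero [IsFiniteMeasure μ] : ∀ᵐ ω ∂μ, ∀ n, P (fun i => S i ω) n ≠ 0 := by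
  classical
  rw [ae_all_iff]
  intro n
  rcases isEmpty_or_nonempty Ω with hΩ | ⟨⟨ω₀⟩⟩
  · simp [Measure.eq_zero_of_isEmpty μ]
  set a₀ := S 0 ω₀
  have : ∀ᵐ ω ∂μ, ∀ w : Fin n → A, P (padWord a₀ w) n = 0 →
      ¬ ∀ j < n, S j ω = padWord a₀ w j := by
    rw [ae_all_iff]
    intro w
    by_cases hw : P (padWord a₀ w) n = 0
    · simp only [hw, true_imp_iff]
      rw [ae_iff]
      simp only [not_not]
      rw [hS.law, hw, ENNReal.ofReal_zero]
    · simp [hw]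
  filter_upwards [this] with ω hω h0
  have hpad : ∀ i < n, S i ω = padWord a₀ (fun i : Fin n => S i ω) i :=
    fun i hi => by rw [padWord_of_lt _ _ hi]
  refine hω (fun i : Fin n => S i ω) ?_ hpad
  rw [← h0]
  exact (hS.dependsOn n fun i hi => hpad i hi).symm

/-- Martingales in terms of the cylinder law. -/
theorem martingale [IsFiniteMeasure μ] {G : (ℕ → A) → ℕ → ℝ}
    (hG : ∀ n, DependsOn (fun e => G e n) (Set.Iio n))
    (h : ∀ e n, ∑ a, P (Function.update e n a) (n + 1) *
      (G (Function.update e n a) (n + 1) - G e n) = 0) :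
    Martingale (fun n ω => G (fun i => S i ω) n) hS.filtration μ := by
  classical
  refine martingale_of_setIntegral_eq_succ
    (fun n => (measurable_letterAlgebra (hG n)).stronglyMeasurable)
    (fun n => hS.integrable (hG n)) fun n s hs => ?_
  have hs' := hS.filtration.le n s hs
  obtain ⟨t, rfl⟩ := exists_word_set hs
  rw [eq_comm, ← sub_eq_zero, ← integral_sub (hS.integrable (hG _)).integrableOn
    (hS.integrable (hG _)).integrableOn, ← integral_indicator hs']
  have hG' : ∀ n m, n ≤ m → DependsOn (fun e => G e n) (Set.Iio m) := fun n m hnm e e' he =>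
    hG n fun i hi => he i (lt_of_lt_of_le hi hnm)
  -- An event of the first `n` letters is a set `t` of words, and its indicator factors out of the
  -- sum over letter `n`.
  have key := hS.integral_eq_zero_of_step (n := n)
    (f := fun e => (if (fun i : Fin n => e i) ∈ t then 1 else 0) * (G e (n + 1) - G e n)) ?_ ?_
  · rw [← key]
    refine integral_congr_ae (ae_of_all _ fun ω => ?_)
    simp only [Set.indicator_apply, Set.mem_preimage, ite_mul, one_mul, zero_mul]
  · intro e e' he
    have h1 : (fun i : Fin n => e i) = fun i : Fin n => e' i :=
      funext fun i => he i (Set.mem_Iio.2 (i.2.trans n.lt_succ_self))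
    have h2 := hG (n + 1) he
    have h3 := hG' n (n + 1) n.le_succ he
    simp only at h1 h2 h3 ⊢
    rw [h1, h2, h3]
  · intro e
    have h1 : ∀ a, (fun i : Fin n => Function.update e n a i) = fun i : Fin n => e i :=
      fun a => funext fun i => Function.update_of_ne i.2.ne _ _
    have h2 : ∀ a, G (Function.update e n a) n = G e n := fun a => DependsOn.update_eq (hG n) e a
    simp only [h1, h2]
    refine Eq.trans ?_ ((congrArg ((if (fun i : Fin n => e i) ∈ t then (1 : ℝ) else 0) * ·)
      (h e n)).trans (mul_zero _))
    rw [Finset.mul_sum]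
    exact Finset.sum_congr rfl fun a _ => by ring

theorem ae_tendsto_of_sq_bdd [IsProbabilityMeasure μ] {G : (ℕ → A) → ℕ → ℝ}
    (hG : ∀ n, DependsOn (fun e => G e n) (Set.Iio n))
    (h : ∀ e n, ∑ a, P (Function.update e n a) (n + 1) *
      (G (Function.update e n a) (n + 1) - G e n) = 0)
    (C : ℝ) (hC : ∀ n, ∫ ω, G (fun i => S i ω) n ^ 2 ∂μ ≤ C) :
    ∀ᵐ ω ∂μ, ∃ c, Tendsto (fun n => G (fun i => S i ω) n) atTop (𝓝 c) := by
  refine (hS.martingale hG h).submartingale.exists_ae_tendsto_of_bdd (R := (1 + C).toNNReal)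
    fun n => ?_
  have hsq : DependsOn (fun e => G e n ^ 2) (Set.Iio n) := fun e e' he => by
    have := hG n he
    simp only at this ⊢
    rw [this]
  rw [eLpNorm_one_eq_lintegral_enorm, ← ofReal_integral_norm_eq_lintegral_enorm
    (hS.integrable (hG n))]
  refine ENNReal.ofReal_le_ofReal ?_
  -- Doob's convergence theorem needs an L¹ bound, supplied by `|x| ≤ 1 + x²`.
  calc ∫ ω, ‖G (fun i => S i ω) n‖ ∂μ ≤ ∫ ω, (1 + G (fun i => S i ω) n ^ 2) ∂μ := by
        refine integral_mono (hS.integrable (hG n)).norm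
          ((integrable_const _).add (hS.integrable hsq)) fun ω => ?_
        simp only [Real.norm_eq_abs]
        nlinarith [sq_nonneg (|G (fun i => S i ω) n| - 1), sq_abs (G (fun i => S i ω) n)]
    _ = 1 + ∫ ω, G (fun i => S i ω) n ^ 2 ∂μ := by
        rw [integral_add (integrable_const _) (hS.integrable hsq)]
        simp
    _ ≤ 1 + C := by linarith [hC n]

end HasCylinderLaw

end Letters

/-! ### Kronecker's lemma and a bound for the sum of inverse squares -/

/-- Kronecker's lemma, for the weights `1, 2, 3, …`. -/
theorem tendsto_average_zero_of_tendsto_sum {a : ℕ → ℝ} {c : ℝ}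
    (h : Tendsto (fun n => ∑ j ∈ Finset.range n, a j / (j + 1)) atTop (𝓝 c)) :
    Tendsto (fun n : ℕ => (n : ℝ)⁻¹ * ∑ j ∈ Finset.range n, a j) atTop (𝓝 0) := by
  set s : ℕ → ℝ := fun n => ∑ j ∈ Finset.range n, a j / (j + 1) with hs
  -- Summation by parts; after division by `n` the right side is `s n` minus the Cesàro mean of `s`,
  -- and both tend to `c`.
  have habel : ∀ n : ℕ, ∑ j ∈ Finset.range n, a j =
      n * s n - ∑ j ∈ Finset.range n, s j := by
    intro n
    induction n with
    | zero => simp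
    | succ n ih =>
      have h1 : s (n + 1) = s n + a n / (n + 1) := Finset.sum_range_succ _ _
      rw [Finset.sum_range_succ, ih, Finset.sum_range_succ, h1]
      push_cast
      have : (n : ℝ) + 1 ≠ 0 := by positivity
      field_simp
      ring
  have h2 := h.sub h.cesaro
  rw [sub_self] at h2
  refine h2.congr' ?_
  filter_upwards [eventually_gt_atTop 0] with n hn
  have : (n : ℝ) ≠ 0 := by positivity
  rw [habel n]
  field_simp

/-- Telescoping of `1/m² ≤ 2 (1/m - 1/(m+1))`. -/
theorem sum_inv_sq_le (n : ℕ) :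
    ∑ j ∈ Finset.range n, (((j : ℝ) + 1) ^ 2)⁻¹ ≤ 2 - 2 * ((n : ℝ) + 1)⁻¹ := by
  induction n with
  | zero => norm_num
  | succ n ih =>
    rw [Finset.sum_range_succ]
    have h1 : (0 : ℝ) < (n : ℝ) + 1 := by positivity
    have : (((n : ℝ) + 1) ^ 2)⁻¹ ≤ 2 * (((n : ℝ) + 1)⁻¹ - ((n : ℝ) + 1 + 1)⁻¹) := by
      rw [inv_sub_inv (by positivity) (by positivity), ← mul_div_assoc, inv_eq_one_div,
        div_le_div_iff₀ (by positivity) (by positivity)]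
      nlinarith
    push_cast
    linarith

/-! ### Strong law for martingale differences and convergence of bounded martingales -/

namespace HasCylinderLaw

variable {A Ω : Type*} [Fintype A] [MeasurableSpace Ω] {μ : Measure Ω}
  {P : (ℕ → A) → ℕ → ℝ} {S : ℕ → Ω → A} (hS : HasCylinderLaw μ P S)
include hS

/-- The strong law of large numbers for bounded martingale differences. -/
theorem ae_tendsto_average_zero_real [IsProbabilityMeasure μ] {D : (ℕ → A) → ℕ → ℝ}
    (hD : ∀ n, DependsOn (fun e => D e n) (Set.Iio (n + 1)))
    (h : ∀ e n, ∑ a, P (Function.update e n a) (n + 1) * D (Function.update e n a) n = 0)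
    {C : ℝ} (hC : ∀ e n, |D e n| ≤ C) :
    ∀ᵐ ω ∂μ, Tendsto (fun n : ℕ => (n : ℝ)⁻¹ * ∑ j ∈ Finset.range n, D (fun i => S i ω) j)
      atTop (𝓝 0) := by
  -- The weights `1/(j+1)` make this martingale bounded in L², hence almost surely convergent;
  -- Kronecker's lemma then gives the averages of `D`.
  set G : (ℕ → A) → ℕ → ℝ := fun e n => ∑ j ∈ Finset.range n, D e j / (j + 1) with hGdef
  have hG : ∀ n, DependsOn (fun e => G e n) (Set.Iio n) := fun n e e' he =>
    Finset.sum_congr rfl fun j hj => congrArg (· / ((j : ℝ) + 1)) <| hD j fun i hi =>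
      he i (Set.mem_Iio.2 (lt_of_lt_of_le (Set.mem_Iio.1 hi) (Finset.mem_range.1 hj)))
  have hsucc : ∀ e n, G e (n + 1) = G e n + D e n / (n + 1) := fun e n =>
    Finset.sum_range_succ _ _
  have hupd : ∀ e n a, G (Function.update e n a) n = G e n := fun e n a =>
    DependsOn.update_eq (hG n) e a
  have hdep : ∀ {f : ℝ → ℝ → ℝ} n, DependsOn (fun e => f (G e n) (D e n)) (Set.Iio (n + 1)) := by
    intro f n e e' he
    have h1 := hG n fun i hi => he i (lt_trans hi n.lt_succ_self)
    have h2 := hD n he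
    simp only at h1 h2 ⊢
    rw [h1, h2]
  have hdepG : ∀ n, DependsOn (fun e => G e n ^ 2) (Set.Iio n) := by
    intro n e e' he
    have h1 := hG n he
    simp only at h1 ⊢
    rw [h1]
  have hsq : ∀ n, ∫ ω, G (fun i => S i ω) n ^ 2 ∂μ ≤
      ∑ j ∈ Finset.range n, C ^ 2 * (((j : ℝ) + 1) ^ 2)⁻¹ := by
    intro n
    induction n with
    | zero => simp [hGdef]
    | succ n ih =>
      have hn : (0 : ℝ) < (n : ℝ) + 1 := by positivity
      -- Orthogonality of increments: `G n` is fixed by the past while `D n` has conditional mean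
      -- zero.
      have horth : ∫ ω, G (fun i => S i ω) n * D (fun i => S i ω) n ∂μ = 0 := by
        refine hS.integral_eq_zero_of_step (f := fun e => G e n * D e n)
          (hdep (f := fun x y => x * y) n) fun e => ?_
        rw [← mul_zero (G e n), ← h e n, Finset.mul_sum]
        refine Finset.sum_congr rfl fun a _ => ?_
        rw [hupd]
        ring
      have hint1 := hS.integrable (hdepG n)
      have hint2 := hS.integrable (hdep (f := fun x y => x * y) n)
      have hint3 := hS.integrable (hdep (f := fun _ y => y ^ 2) n)
      have hexp : ∀ ω, G (fun i => S i ω) (n + 1) ^ 2 = G (fun i => S i ω) n ^ 2 +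
          2 / ((n : ℝ) + 1) * (G (fun i => S i ω) n * D (fun i => S i ω) n) +
          (((n : ℝ) + 1) ^ 2)⁻¹ * D (fun i => S i ω) n ^ 2 := by
        intro ω
        rw [hsucc]
        field_simp
        ring
      have hint12 : Integrable (fun ω => G (fun i => S i ω) n ^ 2 +
          2 / ((n : ℝ) + 1) * (G (fun i => S i ω) n * D (fun i => S i ω) n)) μ :=
        hint1.add (hint2.const_mul _)
      simp_rw [hexp]
      rw [integral_add hint12 (hint3.const_mul _),
        integral_add hint1 (hint2.const_mul _), integral_const_mul, integral_const_mul, horth,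
        mul_zero, add_zero, Finset.sum_range_succ]
      refine add_le_add ih ?_
      rw [mul_comm]
      refine mul_le_mul_of_nonneg_right ?_ (by positivity)
      calc ∫ ω, D (fun i => S i ω) n ^ 2 ∂μ ≤ ∫ _, C ^ 2 ∂μ :=
            integral_mono hint3 (integrable_const _) fun ω => by
              rw [← sq_abs]
              exact pow_le_pow_left₀ (abs_nonneg _) (hC _ _) 2
        _ = C ^ 2 := by simp
  have hconv := hS.ae_tendsto_of_sq_bdd hG (fun e n => ?_) (C ^ 2 * 2) fun n => (hsq n).trans ?_
  · filter_upwards [hconv] with ω ⟨c, hc⟩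
    exact tendsto_average_zero_of_tendsto_sum hc
  · rw [← zero_mul ((n : ℝ) + 1)⁻¹, ← h e n, Finset.sum_mul]
    refine Finset.sum_congr rfl fun a _ => ?_
    rw [hsucc, hupd]
    ring
  · rw [← Finset.mul_sum]
    refine mul_le_mul_of_nonneg_left ((sum_inv_sq_le n).trans ?_) (sq_nonneg C)
    have : (0 : ℝ) ≤ ((n : ℝ) + 1)⁻¹ := by positivity
    linarith

theorem ae_tendsto_average_zero [IsProbabilityMeasure μ] {D : (ℕ → A) → ℕ → ℂ}
    (hD : ∀ n, DependsOn (fun e => D e n) (Set.Iio (n + 1)))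
    (h : ∀ e n, ∑ a, (P (Function.update e n a) (n + 1) : ℂ) * D (Function.update e n a) n = 0)
    {C : ℝ} (hC : ∀ e n, ‖D e n‖ ≤ C) :
    ∀ᵐ ω ∂μ, Tendsto (fun n : ℕ => (n : ℂ)⁻¹ * ∑ j ∈ Finset.range n, D (fun i => S i ω) j)
      atTop (𝓝 0) := by
  have hre := hS.ae_tendsto_average_zero_real (D := fun e n => (D e n).re)
    (fun n e e' he => congrArg Complex.re (hD n he))
    (fun e n => by simpa using congrArg Complex.re (h e n))
    (fun e n => (Complex.abs_re_le_norm _).trans (hC e n))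
  have him := hS.ae_tendsto_average_zero_real (D := fun e n => (D e n).im)
    (fun n e e' he => congrArg Complex.im (hD n he))
    (fun e n => by simpa using congrArg Complex.im (h e n))
    (fun e n => (Complex.abs_im_le_norm _).trans (hC e n))
  filter_upwards [hre, him] with ω h1 h2
  have := ((Complex.continuous_ofReal.tendsto _).comp h1).add
    (((Complex.continuous_ofReal.tendsto _).comp h2).mul_const Complex.I)
  simp only [Complex.ofReal_zero, zero_mul, add_zero] at this
  refine this.congr fun n => ?_
  apply Complex.ext <;> simp

theorem ae_tendsto_of_bdd [IsProbabilityMeasure μ] {G : (ℕ → A) → ℕ → ℂ}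
    (hG : ∀ n, DependsOn (fun e => G e n) (Set.Iio n))
    (h : ∀ e n, ∑ a, (P (Function.update e n a) (n + 1) : ℂ) *
      (G (Function.update e n a) (n + 1) - G e n) = 0)
    {C : ℝ} (hC : ∀ e n, ‖G e n‖ ≤ C) :
    ∀ᵐ ω ∂μ, ∃ c, Tendsto (fun n => G (fun i => S i ω) n) atTop (𝓝 c) := by
  have hbd : ∀ {f : (ℕ → A) → ℕ → ℝ}, (∀ e n, |f e n| ≤ C) → ∀ n,
      ∫ ω, f (fun i => S i ω) n ^ 2 ∂μ ≤ C ^ 2 := by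
    intro f hf n
    have := norm_integral_le_of_norm_le_const (μ := μ) (f := fun ω => f (fun i => S i ω) n ^ 2)
      (C := C ^ 2) (ae_of_all _ fun ω => by
        rw [Real.norm_eq_abs, abs_pow]
        exact pow_le_pow_left₀ (abs_nonneg _) (hf _ _) 2)
    simpa using (le_abs_self _).trans this
  have hre := hS.ae_tendsto_of_sq_bdd (G := fun e n => (G e n).re)
    (fun n e e' he => congrArg Complex.re (hG n he))
    (fun e n => by simpa using congrArg Complex.re (h e n)) _
    (hbd fun e n => (Complex.abs_re_le_norm _).trans (hC e n))
  have him := hS.ae_tendsto_of_sq_bdd (G := fun e n => (G e n).im)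
    (fun n e e' he => congrArg Complex.im (hG n he))
    (fun e n => by simpa using congrArg Complex.im (h e n)) _
    (hbd fun e n => (Complex.abs_im_le_norm _).trans (hC e n))
  filter_upwards [hre, him] with ω ⟨a, ha⟩ ⟨b, hb⟩
  refine ⟨a + b * Complex.I, ?_⟩
  refine (((Complex.continuous_ofReal.tendsto _).comp ha).add
    (((Complex.continuous_ofReal.tendsto _).comp hb).mul_const Complex.I)).congr fun n => ?_
  exact Complex.re_add_im _

end HasCylinderLaw

/-! ### Partial traces, states and complete positivity -/

section Matrices

variable {H M : Type*} [Fintype H]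

theorem posSemidef_traceSystem {τ : Matrix (H × M) (H × M) ℂ} (hτ : τ.PosSemidef) :
    (traceSystem τ).PosSemidef := by
  have : traceSystem τ = ∑ a, τ.submatrix (fun m => (a, m)) (fun m => (a, m)) := by
    ext m m'
    simp [traceSystem, Matrix.sum_apply]
  rw [this]
  exact Matrix.posSemidef_sum _ fun a _ => hτ.submatrix _

variable [Fintype M]

open scoped MatrixOrder Matrix.Norms.L2Operator in
theorem exists_eq_conjTranspose_mul_self {ρ : Matrix M M ℂ} (hρ : ρ.PosSemidef) :
    ∃ B : Matrix M M ℂ, ρ = Bᴴ * B := by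
  classical
  exact CStarAlgebra.nonneg_iff_eq_star_mul_self.mp hρ.nonneg

theorem trace_traceSystem (τ : Matrix (H × M) (H × M) ℂ) : (traceSystem τ).trace = τ.trace := by
  simp only [traceSystem, Matrix.trace, Matrix.diag, Matrix.of_apply, Fintype.sum_prod_type]
  exact Finset.sum_comm

theorem trace_traceMemory (τ : Matrix (H × M) (H × M) ℂ) : (traceMemory τ).trace = τ.trace := by
  simp only [traceMemory, Matrix.trace, Matrix.diag, Matrix.of_apply, Fintype.sum_prod_type]

/-- Duality of the partial trace, which turns the Born rule on system and memory into `tr[E 𝓔(ρ)]`.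
-/
theorem trace_mul_traceMemory [DecidableEq M] (B : Matrix H H ℂ)
    (τ : Matrix (H × M) (H × M) ℂ) :
    (B * traceMemory τ).trace = (τ * (B ⊗ₖ (1 : Matrix M M ℂ))).trace := by
  rw [Matrix.trace_mul_comm B, ← trace_traceMemory (τ * _)]
  congr 1
  ext a b
  simp only [traceMemory, Matrix.mul_apply, Matrix.of_apply, Fintype.sum_prod_type,
    Matrix.kroneckerMap_apply, Matrix.one_apply, mul_ite, mul_one, mul_zero, Finset.sum_ite_eq',
    Finset.mem_univ, if_true, Finset.sum_mul]
  exact Finset.sum_comm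

theorem traceSystem_mul_comm [DecidableEq M] (B : Matrix H H ℂ)
    (τ : Matrix (H × M) (H × M) ℂ) :
    traceSystem (τ * (B ⊗ₖ (1 : Matrix M M ℂ))) = traceSystem ((B ⊗ₖ (1 : Matrix M M ℂ)) * τ) := by
  ext m m'
  simp only [traceSystem, Matrix.mul_apply, Matrix.of_apply, Fintype.sum_prod_type,
    Matrix.kroneckerMap_apply, Matrix.one_apply, mul_ite, mul_one, mul_zero, Finset.sum_ite_eq',
    Finset.sum_ite_eq, ite_mul, zero_mul, Finset.mem_univ, if_true]
  rw [Finset.sum_comm]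
  exact Finset.sum_congr rfl fun _ _ => Finset.sum_congr rfl fun _ _ => mul_comm _ _

theorem posSemidef_interact {U : Matrix (H × M) (M × H) ℂ} {ξ : Matrix M M ℂ} {ρ : Matrix H H ℂ}
    (hξ : ξ.PosSemidef) (hρ : ρ.PosSemidef) : (interact U ξ ρ).PosSemidef :=
  (hξ.kronecker hρ).mul_mul_conjTranspose_same U

theorem trace_interact [DecidableEq H] [DecidableEq M] {U : Matrix (H × M) (M × H) ℂ}
    (hU : IsUnitary U) (ξ : Matrix M M ℂ) (ρ : Matrix H H ℂ) :
    (interact U ξ ρ).trace = ξ.trace * ρ.trace := by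
  rw [interact, Matrix.trace_mul_comm, ← Matrix.mul_assoc, hU.1, Matrix.one_mul,
    Matrix.trace_kronecker]

/-- With `E = B†B`, cyclicity of the partial trace in the traced-out factor replaces `τ (E ⊗ 1)` by
`(B ⊗ 1) τ (B ⊗ 1)†`. -/
theorem posSemidef_traceSystem_mul [DecidableEq H] [DecidableEq M] {τ : Matrix (H × M) (H × M) ℂ}
    (hτ : τ.PosSemidef) {E : Matrix H H ℂ} (hE : E.PosSemidef) :
    (traceSystem (τ * (E ⊗ₖ (1 : Matrix M M ℂ)))).PosSemidef := by
  obtain ⟨B, rfl⟩ := exists_eq_conjTranspose_mul_self hE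
  have h1 : (Bᴴ * B) ⊗ₖ (1 : Matrix M M ℂ) =
      (Bᴴ ⊗ₖ (1 : Matrix M M ℂ)) * (B ⊗ₖ (1 : Matrix M M ℂ)) := by
    rw [← Matrix.mul_kronecker_mul, Matrix.one_mul]
  rw [h1, ← Matrix.mul_assoc, traceSystem_mul_comm, ← Matrix.mul_assoc]
  have h2 : Bᴴ ⊗ₖ (1 : Matrix M M ℂ) = (B ⊗ₖ (1 : Matrix M M ℂ))ᴴ := by
    rw [Matrix.conjTranspose_kronecker, Matrix.conjTranspose_one]
  rw [h2]
  exact posSemidef_traceSystem (hτ.mul_mul_conjTranspose_same _)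

theorem isClosed_setOf_posSemidef : IsClosed {ρ : Matrix M M ℂ | ρ.PosSemidef} := by
  have : OrderClosedTopology ℂ := Complex.orderClosedTopology
  simp only [Matrix.posSemidef_iff_dotProduct_mulVec, Set.ofPred_and, Set.ofPred_forall]
  refine IsClosed.inter (isClosed_eq (by fun_prop) continuous_id) (isClosed_iInter fun v => ?_)
  exact isClosed_le continuous_const (by fun_prop)

theorem isClosed_setOf_isState : IsClosed {ρ : Matrix M M ℂ | IsState ρ} :=
  isClosed_setOf_posSemidef.inter (isClosed_eq (by fun_prop) continuous_const)

/-- A state has entries of modulus at most one. -/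
theorem IsState.norm_apply_le {ρ : Matrix M M ℂ} (hρ : IsState ρ) (i j : M) : ‖ρ i j‖ ≤ 1 := by
  -- Entries of `ρ` are inner products of columns of `B`, whose squared norms are the diagonal
  -- entries and sum to one.
  obtain ⟨B, hB⟩ := exists_eq_conjTranspose_mul_self hρ.1
  have hdiag : ∀ i, ((∑ k, ‖B k i‖ ^ 2 : ℝ) : ℂ) = ρ i i := by
    intro i
    simp [hB, Matrix.mul_apply, ← Complex.normSq_eq_norm_sq, Complex.normSq_eq_conj_mul_self]
  have htr : ∑ i, ∑ k, ‖B k i‖ ^ 2 = 1 := by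
    have := hρ.2
    simp only [Matrix.trace, Matrix.diag, ← hdiag] at this
    exact_mod_cast this
  have hle : ∀ i, ∑ k, ‖B k i‖ ^ 2 ≤ 1 := fun i => by
    rw [← htr]
    exact Finset.single_le_sum (f := fun i => ∑ k, ‖B k i‖ ^ 2)
      (fun _ _ => Finset.sum_nonneg fun _ _ => by positivity) (Finset.mem_univ i)
  have hij : ρ i j = ∑ k, star (B k i) * B k j := by
    simp [hB, Matrix.mul_apply]
  calc ‖ρ i j‖ ≤ ∑ k, ‖star (B k i) * B k j‖ := by
        rw [hij]
        exact norm_sum_le _ _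
    _ ≤ ∑ k, (‖B k i‖ ^ 2 + ‖B k j‖ ^ 2) / 2 := by
        refine Finset.sum_le_sum fun k _ => ?_
        rw [norm_mul, norm_star]
        nlinarith [sq_nonneg (‖B k i‖ - ‖B k j‖)]
    _ ≤ 1 := by
        rw [← Finset.sum_div, Finset.sum_add_distrib]
        linarith [hle i, hle j]

/-- A factorization `ξ = C†C` gives `ξ ⊗ ρ = ∑ J_k ρ J_k†`, where `J_k` tensors with the conjugated
`k`-th row of `C`. The partial trace then sums over the row blocks of `U` labelled by a memory
index. -/
theorem exists_kraus [DecidableEq H] (U : Matrix (H × M) (M × H) ℂ) {ξ : Matrix M M ℂ}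
    (hξ : ξ.PosSemidef) : ∃ W : M × M → Matrix H H ℂ,
      ∀ ρ, inducedMap U ξ ρ = ∑ r, W r * ρ * (W r)ᴴ := by
  obtain ⟨C, hC⟩ := exists_eq_conjTranspose_mul_self hξ
  set J : M → Matrix (M × H) H ℂ := fun k =>
    Matrix.of fun p h => if p.2 = h then star (C k p.1) else 0 with hJ
  refine ⟨fun r => U.submatrix (fun a => (a, r.1)) id * J r.2, fun ρ => ?_⟩
  have h1 : ξ ⊗ₖ ρ = ∑ k, J k * ρ * (J k)ᴴ := by
    ext ⟨m₁, h₁⟩ ⟨m₂, h₂⟩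
    simp only [hJ, Matrix.sum_apply, Matrix.mul_apply, Matrix.of_apply, Matrix.kroneckerMap_apply,
      Matrix.conjTranspose_apply, hC, ite_mul, zero_mul, Finset.sum_ite_eq, Finset.mem_univ,
      if_true, apply_ite star, star_star, star_zero, mul_ite, mul_zero, Finset.sum_mul]
    exact Finset.sum_congr rfl fun k _ => by ring
  have h2 : inducedMap U ξ ρ = ∑ m, U.submatrix (fun a => (a, m)) id * (ξ ⊗ₖ ρ) *
      (U.submatrix (fun a => (a, m)) id)ᴴ := by
    ext a b
    simp only [inducedMap, traceMemory, interact, LinearMap.coe_mk, AddHom.coe_mk, Matrix.of_apply,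
      Matrix.sum_apply]
    rfl
  rw [h2, h1, Fintype.sum_prod_type]
  refine Finset.sum_congr rfl fun m _ => ?_
  rw [Matrix.mul_sum, Matrix.sum_mul]
  refine Finset.sum_congr rfl fun k _ => ?_
  simp only [Matrix.conjTranspose_mul, Matrix.mul_assoc]

theorem isChannel_inducedMap [DecidableEq H] [DecidableEq M] {U : Matrix (H × M) (M × H) ℂ}
    (hU : IsUnitary U) {ξ : Matrix M M ℂ} (hξ : IsState ξ) : IsChannel (inducedMap U ξ) := by
  constructor
  · intro n τ hτ
    obtain ⟨W, hW⟩ := exists_kraus U hξ.1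
    have : ampliation (inducedMap U ξ) n τ =
        ∑ r, (W r ⊗ₖ (1 : Matrix (Fin n) (Fin n) ℂ)) * τ *
          (W r ⊗ₖ (1 : Matrix (Fin n) (Fin n) ℂ))ᴴ := by
      ext ⟨a, i⟩ ⟨b, j⟩
      simp only [ampliation, hW, Matrix.sum_apply, Matrix.mul_apply, Matrix.of_apply,
        Matrix.kroneckerMap_apply, Fintype.sum_prod_type, Matrix.conjTranspose_apply,
        Matrix.one_apply, mul_ite, mul_one, mul_zero, ite_mul, zero_mul, Finset.sum_ite_eq,
        Finset.mem_univ, if_true, apply_ite star, star_zero]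
    rw [this]
    exact Matrix.posSemidef_sum _ fun r _ => hτ.mul_mul_conjTranspose_same _
  · intro ρ
    change (traceMemory (interact U ξ ρ)).trace = _
    rw [trace_traceMemory, trace_interact hU, hξ.2, one_mul]

end Matrices

/-! ### Memory states along a record and the record probabilities -/

section Trajectory

variable {X : Type*} {K : X → Type*} {H M : Type*} [Fintype X] [∀ x, Fintype (K x)]
  [Fintype H] [DecidableEq H] [Fintype M] [DecidableEq M]
  (Q : Scheme X K H) (U : Matrix (H × M) (M × H) ℂ)

/-- The instrument as a linear map of the memory state. -/
def instrumentMap (e : Σ x, K x) : Matrix M M ℂ →ₗ[ℂ] Matrix M M ℂ where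
  toFun := instrument Q U e
  map_add' ξ η := by
    ext a b
    simp [instrument, traceSystem, interact, Matrix.add_kronecker, Matrix.mul_add, Matrix.add_mul,
      Finset.sum_add_distrib]
  map_smul' c ξ := by
    ext a b
    simp [instrument, traceSystem, interact, Matrix.smul_kronecker, Finset.mul_sum]

/-- The average change of the memory state in one run. -/
def averageMap : Matrix M M ℂ →ₗ[ℂ] Matrix M M ℂ :=
  ∑ e : Σ x, K x, (Q.q e.1 : ℂ) • instrumentMap Q U e

theorem averageMap_apply (ξ : Matrix M M ℂ) :
    averageMap Q U ξ = ∑ e : Σ x, K x, (Q.q e.1 : ℂ) • instrument Q U e ξ := by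
  simp [averageMap, LinearMap.sum_apply, instrumentMap]

variable {U}

theorem posSemidef_instrument (e : Σ x, K x) {ξ : Matrix M M ℂ} (hξ : ξ.PosSemidef) :
    (instrument Q U e ξ).PosSemidef :=
  posSemidef_traceSystem_mul (posSemidef_interact hξ (Q.ρ_state e.1).1) (Q.E_pos e.1 e.2)

theorem sum_trace_instrument (hU : IsUnitary U) (x : X) (ξ : Matrix M M ℂ) :
    ∑ k, (instrument Q U ⟨x, k⟩ ξ).trace = ξ.trace := by
  simp only [instrument, trace_traceSystem]
  rw [← Matrix.trace_sum, ← Matrix.mul_sum]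
  have : ∑ k, Q.E x k ⊗ₖ (1 : Matrix M M ℂ) = 1 := by
    rw [← Matrix.one_kronecker_one, ← Q.E_sum x]
    ext ⟨a, m⟩ ⟨b, m'⟩
    simp [Matrix.sum_apply, Finset.sum_mul]
  rw [this, Matrix.mul_one, trace_interact hU, (Q.ρ_state x).2, mul_one]

theorem trace_averageMap (hU : IsUnitary U) (ξ : Matrix M M ℂ) :
    (averageMap Q U ξ).trace = ξ.trace := by
  rw [averageMap_apply, Matrix.trace_sum, Fintype.sum_sigma]
  simp only [Matrix.trace_smul, smul_eq_mul, ← Finset.mul_sum, sum_trace_instrument Q hU]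
  rw [← Finset.sum_mul, ← Complex.ofReal_sum, Q.q_sum, Complex.ofReal_one, one_mul]

theorem IsState.averageMap (hU : IsUnitary U) {ξ : Matrix M M ℂ} (hξ : IsState ξ) :
    IsState (averageMap Q U ξ) := by
  refine ⟨?_, (trace_averageMap Q hU ξ).trans hξ.2⟩
  rw [averageMap_apply]
  exact Matrix.posSemidef_sum _ fun e _ => (posSemidef_instrument Q e hξ.1).smul
    (by exact_mod_cast (Q.q_pos e.1).le)

variable {ξ : Matrix M M ℂ} (hξ : IsState ξ)

theorem trace_instrument_re {η : Matrix M M ℂ} (hη : η.PosSemidef) (e : Σ x, K x) :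
    (((instrument Q U e η).trace.re : ℝ) : ℂ) = (instrument Q U e η).trace :=
  Complex.ext rfl (Complex.nonneg_iff.1 (posSemidef_instrument Q e hη).trace_nonneg).2

-- After an event of probability zero the convention `0⁻¹ = 0` makes the memory state zero, and it
-- stays zero. Statements for all records must allow this case.
include hξ in
theorem isState_or_eq_zero_memoryState (e : ℕ → Σ x, K x) (n : ℕ) :
    IsState (memoryState Q U ξ e n) ∨ memoryState Q U ξ e n = 0 := by
  induction n with
  | zero => exact Or.inl hξ
  | succ n ih =>
    have hpos : (memoryState Q U ξ e n).PosSemidef := by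
      rcases ih with h | h
      · exact h.1
      · rw [h]
        exact Matrix.PosSemidef.zero
    have hI := posSemidef_instrument Q (U := U) (e n) hpos
    rw [memoryState]
    by_cases h0 : (instrument Q U (e n) (memoryState Q U ξ e n)).trace = 0
    · right
      rw [h0, inv_zero, zero_smul]
    · left
      exact ⟨hI.smul (inv_nonneg.2 hI.trace_nonneg), by
        rw [Matrix.trace_smul, smul_eq_mul, inv_mul_cancel₀ h0]⟩

include hξ in
theorem posSemidef_memoryState (e : ℕ → Σ x, K x) (n : ℕ) :
    (memoryState Q U ξ e n).PosSemidef := by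
  rcases isState_or_eq_zero_memoryState Q (U := U) hξ e n with h | h
  · exact h.1
  · rw [h]
    exact Matrix.PosSemidef.zero

theorem dependsOn_memoryState (n : ℕ) :
    DependsOn (fun e => memoryState Q U ξ e n) (Set.Iio n) := by
  induction n with
  | zero => exact fun _ _ _ => rfl
  | succ n ih =>
    intro e e' he
    have h1 := ih fun i hi => he i (lt_trans hi n.lt_succ_self)
    have h2 := he n n.lt_succ_self
    simp only at h1
    simp only [memoryState, h1, h2]

theorem recordProb_succ (e : ℕ → Σ x, K x) (n : ℕ) : recordProb Q U ξ e (n + 1) =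
    recordProb Q U ξ e n * (Q.q (e n).1 *
      (instrument Q U (e n) (memoryState Q U ξ e n)).trace.re) :=
  Finset.prod_range_succ _ _

theorem dependsOn_recordProb (n : ℕ) :
    DependsOn (fun e => recordProb Q U ξ e n) (Set.Iio n) := fun e e' he =>
  Finset.prod_congr rfl fun j hj => by
    have h1 := dependsOn_memoryState Q (U := U) (ξ := ξ) j
      fun i hi => he i (lt_trans hi (Finset.mem_range.1 hj))
    have h2 := he j (Finset.mem_range.1 hj)
    simp only at h1
    rw [h1, h2]

include hξ in
theorem recordProb_nonneg (e : ℕ → Σ x, K x) (n : ℕ) : 0 ≤ recordProb Q U ξ e n :=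
  Finset.prod_nonneg fun j _ => mul_nonneg (Q.q_pos _).le
    (Complex.nonneg_iff.1 (posSemidef_instrument Q (e j)
      (posSemidef_memoryState Q hξ e j)).trace_nonneg).1

/-- A zero state after at least one run forces the last Born weight, a factor of the record
probability, to vanish. -/
theorem isState_memoryState_of_recordProb_ne_zero {e : ℕ → Σ x, K x} {n : ℕ}
    (h : recordProb Q U ξ e n ≠ 0) (hξ : IsState ξ) : IsState (memoryState Q U ξ e n) := by
  rcases isState_or_eq_zero_memoryState Q (U := U) hξ e n with h' | h'
  · exact h'
  · cases n with
    | zero => exact hξ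
    | succ n =>
      exfalso
      apply h
      rw [recordProb_succ]
      have : (instrument Q U (e n) (memoryState Q U ξ e n)).trace = 0 := by
        by_contra h0
        rw [memoryState, smul_eq_zero, inv_eq_zero] at h'
        rcases h' with h' | h'
        · exact h0 h'
        · exact h0 (by rw [h', Matrix.trace_zero])
      rw [this, Complex.zero_re, mul_zero, mul_zero]

theorem recordProb_update (e : ℕ → Σ x, K x) (n : ℕ) (a : Σ x, K x) :
    recordProb Q U ξ (Function.update e n a) (n + 1) =
    recordProb Q U ξ e n * (Q.q a.1 * (instrument Q U a (memoryState Q U ξ e n)).trace.re) := by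
  have h1 := DependsOn.update_eq (dependsOn_recordProb Q (U := U) (ξ := ξ) n) e a
  have h2 := DependsOn.update_eq (dependsOn_memoryState Q (U := U) (ξ := ξ) n) e a
  rw [recordProb_succ, h1, h2, Function.update_self]

-- Undoes the normalisation, even for impossible events: a positive semidefinite matrix of trace
-- zero is zero.
include hξ in
theorem trace_re_smul_memoryState_update (e : ℕ → Σ x, K x) (n : ℕ) (a : Σ x, K x) :
    ((instrument Q U a (memoryState Q U ξ e n)).trace.re : ℂ) •
      memoryState Q U ξ (Function.update e n a) (n + 1) =
    instrument Q U a (memoryState Q U ξ e n) := by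
  have h2 := DependsOn.update_eq (dependsOn_memoryState Q (U := U) (ξ := ξ) n) e a
  have hpos := posSemidef_memoryState Q (U := U) hξ e n
  rw [trace_instrument_re Q hpos, memoryState, h2, Function.update_self, smul_smul]
  by_cases h0 : (instrument Q U a (memoryState Q U ξ e n)).trace = 0
  · rw [(posSemidef_instrument Q a hpos).trace_eq_zero_iff.1 h0, smul_zero]
  · rw [mul_inv_cancel₀ h0, one_smul]

end Trajectory

/-! ### Mean ergodic decomposition of functionals -/

open Module in
/-- Mean ergodic decomposition for the transpose of a linear map whose orbits are bounded on a
spanning set: every functional is the sum of an invariant one and a coboundary. -/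
theorem exists_invariant_add_coboundary {V : Type*} [AddCommGroup V] [Module ℂ V]
    [FiniteDimensional ℂ V] (T : V →ₗ[ℂ] V) (s : Set V) (hs : Submodule.span ℂ s = ⊤)
    (hT : ∀ (g : V →ₗ[ℂ] ℂ), ∀ v ∈ s, ∃ C : ℝ, ∀ n : ℕ, ‖g ((T ^ n) v)‖ ≤ C)
    (φ : V →ₗ[ℂ] ℂ) :
    ∃ φ₁ ψ : V →ₗ[ℂ] ℂ, (∀ v, φ₁ (T v) = φ₁ v) ∧ ∀ v, φ v = φ₁ v + (ψ (T v) - ψ v) := by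
  set N : Dual ℂ V →ₗ[ℂ] Dual ℂ V := T.dualMap - LinearMap.id with hN
  have hNapp : ∀ f v, N f v = f (T v) - f v := fun f v => rfl
  -- If `N g` is invariant, then `g (T^n v) = g v + n * N g v`; boundedness of the orbit forces `N g
  -- v = 0`.
  have hdisj : Disjoint (LinearMap.ker N) (LinearMap.range N) := by
    rw [Submodule.disjoint_def]
    rintro f hf ⟨g, rfl⟩
    have hinv : ∀ v, N g (T v) = N g v := fun v => by
      have := LinearMap.congr_fun (LinearMap.mem_ker.1 hf) v
      rwa [hNapp, LinearMap.zero_apply, sub_eq_zero] at this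
    have hinvn : ∀ (n : ℕ) v, N g ((T ^ n) v) = N g v := by
      intro n
      induction n with
      | zero => simp
      | succ n ih => exact fun v => by rw [pow_succ, Module.End.mul_apply, ih, hinv]
    have hiter : ∀ (n : ℕ) v, g ((T ^ n) v) = g v + n * N g v := by
      intro n v
      induction n with
      | zero => simp
      | succ n ih =>
        have := hNapp g ((T ^ n) v)
        rw [hinvn] at this
        rw [pow_succ', Module.End.mul_apply, sub_eq_iff_eq_add.1 this.symm, ih]
        push_cast
        ring
    refine LinearMap.ext_on hs fun v hv => ?_
    obtain ⟨C, hC⟩ := hT g v hv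
    by_contra hne
    have hpos : 0 < ‖N g v‖ := norm_pos_iff.2 hne
    obtain ⟨n, hn⟩ := exists_nat_gt ((C + ‖g v‖) / ‖N g v‖)
    rw [div_lt_iff₀ hpos] at hn
    have h1 : (n : ℂ) * N g v = g ((T ^ n) v) - g v := by rw [hiter]; ring
    have h2 := norm_sub_le (g ((T ^ n) v)) (g v)
    rw [← h1, norm_mul, Complex.norm_natCast] at h2
    linarith [hC n]
  -- Rank-nullity upgrades disjointness of kernel and range to a direct sum.
  have hcompl : IsCompl (LinearMap.ker N) (LinearMap.range N) := by
    refine (Submodule.isCompl_iff_disjoint _ _ ?_).2 hdisj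
    rw [add_comm, LinearMap.finrank_range_add_finrank_ker]
  have hφ : φ ∈ LinearMap.ker N ⊔ LinearMap.range N := by
    rw [hcompl.sup_eq_top]
    trivial
  obtain ⟨φ₁, h₁, _, ⟨ψ, rfl⟩, h⟩ := Submodule.mem_sup.1 hφ
  refine ⟨φ₁, ψ, fun v => ?_, fun v => ?_⟩
  · have := LinearMap.congr_fun (LinearMap.mem_ker.1 h₁) v
    rwa [hNapp, LinearMap.zero_apply, sub_eq_zero] at this
  · rw [← h, ← hNapp]
    rfl

-- Positive elements span a C⋆-algebra, and each nonzero one is a multiple of a state. Boundedness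
-- of orbits thus need only be checked on states.
open scoped MatrixOrder Matrix.Norms.L2Operator in
theorem span_isState {M : Type*} [Fintype M] :
    Submodule.span ℂ {ρ : Matrix M M ℂ | IsState ρ} = ⊤ := by
  classical
  rw [eq_top_iff, ← CStarAlgebra.span_nonneg, Submodule.span_le]
  intro ρ hρ
  have hρ' : ρ.PosSemidef := Matrix.nonneg_iff_posSemidef.1 hρ
  by_cases h0 : ρ.trace = 0
  · rw [hρ'.trace_eq_zero_iff.1 h0]
    exact Submodule.zero_mem _
  · have : ρ = ρ.trace • (ρ.trace⁻¹ • ρ) := by rw [smul_smul, mul_inv_cancel₀ h0, one_smul]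
    rw [this]
    refine Submodule.smul_mem _ _ (Submodule.subset_span ⟨hρ'.smul
      (inv_nonneg.2 hρ'.trace_nonneg), ?_⟩)
    rw [Matrix.trace_smul, smul_eq_mul, inv_mul_cancel₀ h0]

theorem IsState.norm_functional_le {M : Type*} [Fintype M] [DecidableEq M] {ρ : Matrix M M ℂ}
    (hρ : IsState ρ) (φ : Matrix M M ℂ →ₗ[ℂ] ℂ) :
    ‖φ ρ‖ ≤ ∑ i, ∑ j, ‖φ (Matrix.single i j 1)‖ := by
  have : φ ρ = ∑ i, ∑ j, ρ i j * φ (Matrix.single i j 1) := by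
    conv_lhs => rw [Matrix.matrix_eq_sum_single ρ]
    simp only [map_sum]
    refine Finset.sum_congr rfl fun i _ => Finset.sum_congr rfl fun j _ => ?_
    rw [← smul_eq_mul, ← map_smul, Matrix.smul_single, smul_eq_mul, mul_one]
  rw [this]
  refine (norm_sum_le _ _).trans (Finset.sum_le_sum fun i _ =>
    (norm_sum_le _ _).trans (Finset.sum_le_sum fun j _ => ?_))
  rw [norm_mul]
  exact mul_le_of_le_one_left (norm_nonneg _) (hρ.norm_apply_le i j)

theorem tendsto_average_apply {M : Type*} {φ : Matrix M M ℂ →ₗ[ℂ] ℂ} {η : ℕ → Matrix M M ℂ} {c : ℂ}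
    (h : Tendsto (fun n => φ (η n)) atTop (𝓝 c)) :
    Tendsto (fun n : ℕ => φ ((n : ℂ)⁻¹ • ∑ j ∈ Finset.range n, η j)) atTop (𝓝 c) := by
  refine h.cesaro_smul.congr fun n => ?_
  rw [map_smul, map_sum, Complex.real_smul, smul_eq_mul]
  push_cast
  rfl

/-! ### One-step means and convergence of averaged functionals -/

section Convergence

variable {X : Type*} {K : X → Type*} {H M : Type*} [Fintype X] [∀ x, Fintype (K x)]
  [Fintype H] [DecidableEq H] [Fintype M] [DecidableEq M]
  {Q : Scheme X K H} {U : Matrix (H × M) (M × H) ℂ} {ξ : Matrix M M ℂ}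

theorem norm_functional_memoryState_le (Q : Scheme X K H) (U : Matrix (H × M) (M × H) ℂ)
    (hξ : IsState ξ) (φ : Matrix M M ℂ →ₗ[ℂ] ℂ) (e : ℕ → Σ x, K x) (n : ℕ) :
    ‖φ (memoryState Q U ξ e n)‖ ≤ ∑ i, ∑ j, ‖φ (Matrix.single i j 1)‖ := by
  rcases isState_or_eq_zero_memoryState Q (U := U) hξ e n with h | h
  · exact h.norm_functional_le φ
  · rw [h, map_zero, norm_zero]
    positivity

/-- The mean of a function of the next event. -/
theorem sum_recordProb_update (hξ : IsState ξ) (e : ℕ → Σ x, K x) (n : ℕ)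
    (c : (Σ x, K x) → ℂ) :
    ∑ a, (recordProb Q U ξ (Function.update e n a) (n + 1) : ℂ) * c a =
    recordProb Q U ξ e n *
      ∑ a, Q.q a.1 * (instrument Q U a (memoryState Q U ξ e n)).trace * c a := by
  rw [Finset.mul_sum]
  refine Finset.sum_congr rfl fun a _ => ?_
  rw [recordProb_update]
  push_cast
  rw [trace_instrument_re Q (posSemidef_memoryState Q hξ e n)]
  ring

/-- The state can fail to have trace one only on records of weight zero, so the weighted identity
holds for every record. -/
theorem recordProb_mul_trace (hξ : IsState ξ) (e : ℕ → Σ x, K x) (n : ℕ) :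
    (recordProb Q U ξ e n : ℂ) * (memoryState Q U ξ e n).trace = recordProb Q U ξ e n := by
  by_cases h : recordProb Q U ξ e n = 0
  · simp [h]
  · rw [(isState_memoryState_of_recordProb_ne_zero Q h hξ).2, mul_one]

theorem sum_recordProb_update_const (hU : IsUnitary U) (hξ : IsState ξ) (e : ℕ → Σ x, K x) (n : ℕ)
    (c : ℂ) :
    ∑ a, (recordProb Q U ξ (Function.update e n a) (n + 1) : ℂ) * c =
    recordProb Q U ξ e n * c := by
  rw [sum_recordProb_update hξ, ← Finset.sum_mul, ← mul_assoc]
  congr 1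
  conv_rhs => rw [← recordProb_mul_trace hξ, ← trace_averageMap Q hU, averageMap_apply,
    Matrix.trace_sum]
  simp only [Matrix.trace_smul, smul_eq_mul]

/-- The mean of a functional of the next memory state. -/
theorem sum_recordProb_update_functional (hξ : IsState ξ) (e : ℕ → Σ x, K x) (n : ℕ)
    (φ : Matrix M M ℂ →ₗ[ℂ] ℂ) :
    ∑ a, (recordProb Q U ξ (Function.update e n a) (n + 1) : ℂ) *
      φ (memoryState Q U ξ (Function.update e n a) (n + 1)) =
    recordProb Q U ξ e n * φ (averageMap Q U (memoryState Q U ξ e n)) := by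
  rw [averageMap_apply, map_sum, Finset.mul_sum]
  refine Finset.sum_congr rfl fun a _ => ?_
  rw [← trace_re_smul_memoryState_update Q hξ, recordProb_update, map_smul, map_smul]
  push_cast
  simp only [smul_eq_mul]
  ring

open Classical in
/-- The mean of a function of the next setting. -/
theorem sum_recordProb_update_setting (hU : IsUnitary U) (hξ : IsState ξ) (e : ℕ → Σ x, K x)
    (n : ℕ) (x : X) :
    ∑ a, (recordProb Q U ξ (Function.update e n a) (n + 1) : ℂ) * (if a.1 = x then 1 else 0) =
    recordProb Q U ξ e n * Q.q x := by
  rw [sum_recordProb_update hξ, Fintype.sum_sigma, Finset.sum_eq_single x]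
  · simp only [if_true, mul_one, ← Finset.mul_sum, sum_trace_instrument Q hU]
    rw [mul_left_comm, recordProb_mul_trace hξ, mul_comm]
  · intro y _ hy
    simp [hy]
  · simp

open Classical in
/-- The mean of the indicator of the next event. -/
theorem sum_recordProb_update_event (hξ : IsState ξ) (e : ℕ → Σ x, K x)
    (n : ℕ) (b : Σ x, K x) :
    ∑ a, (recordProb Q U ξ (Function.update e n a) (n + 1) : ℂ) * (if a = b then 1 else 0) =
    recordProb Q U ξ e n * (Q.q b.1 * (instrument Q U b (memoryState Q U ξ e n)).trace) := by
  rw [sum_recordProb_update hξ]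
  simp

variable {Ω : Type*} [MeasurableSpace Ω] {μ : Measure Ω} {S : ℕ → Ω → Σ x, K x}

theorem IsRandomizedRun.hasCylinderLaw (hS : IsRandomizedRun μ Q U ξ S) (hξ : IsState ξ) :
    HasCylinderLaw μ (recordProb Q U ξ) S where
  measurableSet := hS.measurable
  nonneg := recordProb_nonneg Q hξ
  dependsOn := dependsOn_recordProb Q
  law := hS.law

variable [IsProbabilityMeasure μ]

/-- The invariant part of `φ` contributes a convergent martingale, the coboundary part only terms
whose averages vanish. -/
theorem IsRandomizedRun.ae_tendsto_functional_average (hU : IsUnitary U) (hξ : IsState ξ)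
    (hS : IsRandomizedRun μ Q U ξ S) (φ : Matrix M M ℂ →ₗ[ℂ] ℂ) :
    ∀ᵐ ω ∂μ, ∃ c, Tendsto (fun n : ℕ => φ ((n : ℂ)⁻¹ •
      ∑ j ∈ Finset.range n, memoryState Q U ξ (fun i => S i ω) j)) atTop (𝓝 c) := by
  classical
  have hlaw := hS.hasCylinderLaw hξ
  have hstate : ∀ ρ : Matrix M M ℂ, IsState ρ → ∀ n, IsState ((averageMap Q U ^ n) ρ) := by
    intro ρ hρ n
    induction n with
    | zero => exact hρ
    | succ n ih =>
      rw [pow_succ', Module.End.mul_apply]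
      exact ih.averageMap Q hU
  obtain ⟨φ₁, ψ, h₁, hφ⟩ := exists_invariant_add_coboundary (averageMap Q U) _ span_isState
    (fun g ρ hρ => ⟨_, fun n => (hstate ρ hρ n).norm_functional_le g⟩) φ
  have hdep : ∀ (f : Matrix M M ℂ →ₗ[ℂ] ℂ) n,
      DependsOn (fun e => f (memoryState Q U ξ e n)) (Set.Iio n) := fun f n e e' he =>
    congrArg f (dependsOn_memoryState Q n he)
  have hinv := hlaw.ae_tendsto_of_bdd (G := fun e n => φ₁ (memoryState Q U ξ e n)) (hdep φ₁)
    (fun e n => by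
      simp only [mul_sub, Finset.sum_sub_distrib]
      rw [sum_recordProb_update_functional hξ, sum_recordProb_update_const hU hξ, h₁, sub_self])
    (norm_functional_memoryState_le Q U hξ φ₁)
  have hcob := hlaw.ae_tendsto_average_zero
    (D := fun e n => ψ (memoryState Q U ξ e (n + 1)) -
      ψ (averageMap Q U (memoryState Q U ξ e n)))
    (fun n e e' he => congrArg₂ (· - ·) (hdep ψ (n + 1) he)
      (hdep (ψ ∘ₗ averageMap Q U) n fun i hi => he i (lt_trans hi n.lt_succ_self)))
    (fun e n => by
      have h2 := fun a => DependsOn.update_eq (dependsOn_memoryState Q (U := U) (ξ := ξ) n) e a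
      simp only [mul_sub, Finset.sum_sub_distrib, h2]
      rw [sum_recordProb_update_functional hξ, sum_recordProb_update_const hU hξ, sub_self])
    (fun e n => (norm_sub_le _ _).trans (add_le_add
      (norm_functional_memoryState_le Q U hξ ψ e (n + 1))
      (norm_functional_memoryState_le Q U hξ (ψ ∘ₗ averageMap Q U) e n)))
  filter_upwards [hinv, hcob] with ω ⟨c, hc⟩ h0
  refine ⟨c, ?_⟩
  set η := memoryState Q U ξ (fun i => S i ω) with hη
  -- The telescoped sum leaves two boundary terms, each bounded uniformly in `n`.
  have hbdry : Tendsto (fun n : ℕ => (n : ℂ)⁻¹ * (ψ (η n) - ψ (η 0))) atTop (𝓝 0) := by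
    rw [tendsto_zero_iff_norm_tendsto_zero]
    set B := ∑ i, ∑ j, ‖ψ (Matrix.single i j 1)‖
    refine squeeze_zero (fun _ => norm_nonneg _) (fun n => ?_)
      (by simpa using tendsto_inv_atTop_nhds_zero_nat (𝕜 := ℝ).mul_const (B + B))
    rw [norm_mul, norm_inv, Complex.norm_natCast]
    exact mul_le_mul_of_nonneg_left ((norm_sub_le _ _).trans (add_le_add
      (norm_functional_memoryState_le Q U hξ ψ _ n)
      (norm_functional_memoryState_le Q U hξ ψ _ 0))) (by positivity)
  have := (tendsto_average_apply hc).add (hbdry.sub h0)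
  rw [sub_self, add_zero] at this
  refine this.congr fun n => ?_
  rw [hφ ((n : ℂ)⁻¹ • _)]
  congr 1
  rw [Finset.sum_sub_distrib]
  have htel := Finset.sum_range_sub (fun j => ψ (η j)) n
  rw [Finset.sum_sub_distrib] at htel
  simp only [map_smul, map_sum, smul_eq_mul]
  rw [← mul_sub, ← mul_sub, ← htel]
  congr 1
  ring

end Convergence

/-! ### Average state, setting counts and event counts -/

section Averages

theorem settingCount_eq_sum {X : Type*} {K : X → Type*} (e : ℕ → Σ x, K x) (x : X)
    (n : ℕ) [DecidableEq X] :
    (settingCount e x n : ℂ) = ∑ j ∈ Finset.range n, if (e j).1 = x then 1 else 0 := by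
  rw [settingCount, runsWith, Finset.sum_boole]
  congr!

variable {X : Type*} {K : X → Type*} {H M : Type*} [Fintype X] [∀ x, Fintype (K x)]
  [Fintype H] [DecidableEq H] [Fintype M] [DecidableEq M]
  {Q : Scheme X K H} {U : Matrix (H × M) (M × H) ℂ} {ξ : Matrix M M ℂ}
  {Ω : Type*} [MeasurableSpace Ω] {μ : Measure Ω} [IsProbabilityMeasure μ]
  {S : ℕ → Ω → Σ x, K x}

theorem isState_average {M : Type*} [Fintype M] {η : ℕ → Matrix M M ℂ} (hη : ∀ n, IsState (η n))
    {n : ℕ} (hn : n ≠ 0) : IsState ((n : ℂ)⁻¹ • ∑ j ∈ Finset.range n, η j) := by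
  refine ⟨(Matrix.posSemidef_sum _ fun j _ => (hη j).1).smul (by positivity), ?_⟩
  rw [Matrix.trace_smul, Matrix.trace_sum, Finset.sum_congr rfl fun j _ => (hη j).2]
  simp [hn]

/-- Almost surely the memory states have an average, and it is a state. -/
theorem IsRandomizedRun.ae_exists_average (hU : IsUnitary U) (hξ : IsState ξ)
    (hS : IsRandomizedRun μ Q U ξ S) :
    ∀ᵐ ω ∂μ, (∀ n, IsState (memoryState Q U ξ (fun i => S i ω) n)) ∧
      ∃ ξbar : Matrix M M ℂ, IsState ξbar ∧ Tendsto (fun n : ℕ => (n : ℂ)⁻¹ •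
        ∑ j ∈ Finset.range n, memoryState Q U ξ (fun i => S i ω) j) atTop (𝓝 ξbar) := by
  -- Finitely many entries suffice, so one null set serves them all.
  have hent : ∀ᵐ ω ∂μ, ∀ i j, ∃ c, Tendsto (fun n : ℕ => ((n : ℂ)⁻¹ •
      ∑ l ∈ Finset.range n, memoryState Q U ξ (fun i => S i ω) l) i j) atTop (𝓝 c) := by
    simp only [ae_all_iff]
    exact fun i j => hS.ae_tendsto_functional_average hU hξ (Matrix.entryLinearMap ℂ ℂ i j)
  filter_upwards [hent, (hS.hasCylinderLaw hξ).ae_ne_zero] with ω hω hne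
  have hst := fun n => isState_memoryState_of_recordProb_ne_zero Q (hne n) hξ
  choose ξbar hξbar using hω
  have hlim : Tendsto (fun n : ℕ => (n : ℂ)⁻¹ •
      ∑ j ∈ Finset.range n, memoryState Q U ξ (fun i => S i ω) j) atTop (𝓝 ξbar) :=
    tendsto_pi_nhds.2 fun i => tendsto_pi_nhds.2 fun j => hξbar i j
  refine ⟨hst, ξbar, isClosed_setOf_isState.mem_of_tendsto hlim ?_, hlim⟩
  filter_upwards [eventually_ne_atTop 0] with n hn
  exact isState_average hst hn

open Classical in
/-- The selection of the setting is asymptotically uncorrelated with the memory state. -/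
theorem IsRandomizedRun.ae_tendsto_setting_functional (hU : IsUnitary U) (hξ : IsState ξ)
    (hS : IsRandomizedRun μ Q U ξ S) (x : X) (φ : Matrix M M ℂ →ₗ[ℂ] ℂ) :
    ∀ᵐ ω ∂μ, Tendsto (fun n : ℕ => (n : ℂ)⁻¹ * ∑ j ∈ Finset.range n,
      ((if (S j ω).1 = x then 1 else 0) - (Q.q x : ℂ)) *
        φ (memoryState Q U ξ (fun i => S i ω) j)) atTop (𝓝 0) := by
  refine (hS.hasCylinderLaw hξ).ae_tendsto_average_zero
    (D := fun e n => ((if (e n).1 = x then 1 else 0) - (Q.q x : ℂ)) * φ (memoryState Q U ξ e n))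
    (fun n e e' he => ?_) (fun e n => ?_)
    (C := (1 + ‖(Q.q x : ℂ)‖) * ∑ i, ∑ j, ‖φ (Matrix.single i j 1)‖) fun e n => ?_
  · have h1 := dependsOn_memoryState Q (U := U) (ξ := ξ) n fun i hi =>
      he i (lt_trans hi n.lt_succ_self)
    have h2 := he n n.lt_succ_self
    simp only at h1 ⊢
    rw [h1, h2]
  · have h2 := fun a => DependsOn.update_eq (dependsOn_memoryState Q (U := U) (ξ := ξ) n) e a
    simp only [h2, Function.update_self, ← mul_assoc]
    rw [← Finset.sum_mul]
    simp only [mul_sub, Finset.sum_sub_distrib]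
    rw [sum_recordProb_update_setting hU hξ, sum_recordProb_update_const hU hξ, sub_self, zero_mul]
  · rw [norm_mul]
    refine mul_le_mul ((norm_sub_le _ _).trans (add_le_add ?_ le_rfl))
      (norm_functional_memoryState_le Q U hξ φ e n) (norm_nonneg _) (by positivity)
    split_ifs <;> simp

-- The functional `φ = tr` of the preceding result: almost surely every memory state has trace one.
open Classical in
theorem IsRandomizedRun.ae_tendsto_setting (hU : IsUnitary U) (hξ : IsState ξ)
    (hS : IsRandomizedRun μ Q U ξ S) (x : X) :
    ∀ᵐ ω ∂μ, Tendsto (fun n : ℕ => (n : ℂ)⁻¹ * ∑ j ∈ Finset.range n,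
      ((if (S j ω).1 = x then 1 else 0) - (Q.q x : ℂ))) atTop (𝓝 0) := by
  filter_upwards [hS.ae_tendsto_setting_functional hU hξ x (Matrix.traceLinearMap M ℂ ℂ),
    hS.ae_exists_average hU hξ] with ω h1 h2
  refine h1.congr fun n => congrArg _ (Finset.sum_congr rfl fun j _ => ?_)
  rw [Matrix.traceLinearMap_apply, (h2.1 j).2, mul_one]

open Classical in
/-- The events obey the Born rule on average. -/
theorem IsRandomizedRun.ae_tendsto_event (hU : IsUnitary U) (hξ : IsState ξ)
    (hS : IsRandomizedRun μ Q U ξ S) (b : Σ x, K x) :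
    ∀ᵐ ω ∂μ, Tendsto (fun n : ℕ => (n : ℂ)⁻¹ * ∑ j ∈ Finset.range n,
      ((if S j ω = b then 1 else 0) - Q.q b.1 *
        (instrument Q U b (memoryState Q U ξ (fun i => S i ω) j)).trace)) atTop (𝓝 0) := by
  set φ : Matrix M M ℂ →ₗ[ℂ] ℂ := (Q.q b.1 : ℂ) • Matrix.traceLinearMap M ℂ ℂ ∘ₗ
    instrumentMap Q U b with hφ
  refine (hS.hasCylinderLaw hξ).ae_tendsto_average_zero
    (D := fun e n => (if e n = b then 1 else 0) - φ (memoryState Q U ξ e n))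
    (fun n e e' he => ?_) (fun e n => ?_)
    (C := 1 + ∑ i, ∑ j, ‖φ (Matrix.single i j 1)‖) fun e n => ?_
  · have h1 := dependsOn_memoryState Q (U := U) (ξ := ξ) n fun i hi =>
      he i (lt_trans hi n.lt_succ_self)
    have h2 := he n n.lt_succ_self
    simp only at h1 ⊢
    rw [h1, h2]
  · have h2 := fun a => DependsOn.update_eq (dependsOn_memoryState Q (U := U) (ξ := ξ) n) e a
    simp only [h2, Function.update_self, mul_sub, Finset.sum_sub_distrib]
    rw [sum_recordProb_update_event hξ, sum_recordProb_update_const hU hξ]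
    exact sub_self _
  · refine (norm_sub_le _ _).trans (add_le_add ?_
      (norm_functional_memoryState_le Q U hξ φ e n))
    split_ifs <;> simp

theorem trace_interact_mul (Q : Scheme X K H) (U : Matrix (H × M) (M × H) ℂ)
    (ξ : Matrix M M ℂ) (x : X) (k : K x) :
    (interact U ξ (Q.ρ x) * (Q.E x k ⊗ₖ (1 : Matrix M M ℂ))).trace =
      (instrument Q U ⟨x, k⟩ ξ).trace :=
  (trace_traceSystem _).symm

/-- Turns averages per run into averages per selected run: the factors `n⁻¹` cancel in the quotient.
-/
theorem tendsto_inv_smul_of_sub {V : Type*} [AddCommGroup V] [TopologicalSpace V] [Module ℂ V]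
    [ContinuousSMul ℂ V] {N : ℕ → ℂ} {v : ℕ → V} {q : ℂ} {l : V} (hq : q ≠ 0)
    (hN : Tendsto (fun n : ℕ => (n : ℂ)⁻¹ * N n) atTop (𝓝 q))
    (hv : Tendsto (fun n : ℕ => (n : ℂ)⁻¹ • v n) atTop (𝓝 (q • l))) :
    Tendsto (fun n : ℕ => (N n)⁻¹ • v n) atTop (𝓝 l) := by
  have := (hN.inv₀ hq).smul hv
  rw [smul_smul, inv_mul_cancel₀ hq, one_smul] at this
  refine this.congr' ?_
  filter_upwards [eventually_ne_atTop 0] with n hn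
  have hn' : (n : ℂ) ≠ 0 := Nat.cast_ne_zero.2 hn
  rw [smul_smul, mul_inv, inv_inv, mul_right_comm, mul_inv_cancel₀ hn', one_mul]

end Averages

end MemoryQPT

/-! ### Assembly on the almost sure event -/

theorem theorem2 {X : Type*} {K : X → Type*} {H M : Type*}
    [Fintype X] [∀ x, Fintype (K x)] [Fintype H] [DecidableEq H] [Fintype M] [DecidableEq M]
    (Q : Scheme X K H) (U : Matrix (H × M) (M × H) ℂ) (hU : IsUnitary U)
    (ξ : Matrix M M ℂ) (hξ : IsState ξ)
    {Ω : Type*} [MeasurableSpace Ω] (μ : Measure Ω) [IsProbabilityMeasure μ]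
    (S : ℕ → Ω → Σ x, K x) (hS : IsRandomizedRun μ Q U ξ S) :
    ∀ᵐ ω ∂μ, ∃ ξbar : Matrix M M ℂ, IsState ξbar ∧
      -- `ξbar` is the average memory state, over all runs and over the runs with any one setting
      Tendsto (fun n : ℕ => (n : ℂ)⁻¹ •
          ∑ j ∈ Finset.range n, memoryState Q U ξ (fun i => S i ω) j) atTop (𝓝 ξbar) ∧
      (∀ x, Tendsto (fun n : ℕ => (settingCount (fun i => S i ω) x n : ℂ)⁻¹ •
          ∑ j ∈ runsWith (fun i => S i ω) x n, memoryState Q U ξ (fun i => S i ω) j)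
          atTop (𝓝 ξbar)) ∧
      ∃ p : ∀ x, K x → ℝ,
        -- the observed frequencies converge to `p`
        (∀ x k, Tendsto (fun n : ℕ => frequency (fun i => S i ω) n x k) atTop (𝓝 (p x k))) ∧
        (∀ x k, (p x k : ℂ) =
          (interact U ξbar (Q.ρ x) * (Q.E x k ⊗ₖ (1 : Matrix M M ℂ))).trace) ∧
        -- `p` is the table of the memoryless average channel, which is what is reconstructed
        IsChannel (inducedMap U ξbar) ∧
        IsTableOf Q (inducedMap U ξbar) p ∧
        ∀ R, IsReconstruction Q R →
          R p = inducedMap U ξbar ∧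
          ((∀ σ, ContinuousAt (fun t => R t σ) p) →
            ∀ σ, Tendsto (fun n : ℕ => R (frequency (fun i => S i ω) n) σ) atTop
              (𝓝 (inducedMap U ξbar σ))) := by
  classical
  have h1 : ∀ᵐ ω ∂μ, ∀ x i j, Tendsto (fun n : ℕ => (n : ℂ)⁻¹ * ∑ l ∈ Finset.range n,
      ((if (S l ω).1 = x then 1 else 0) - (Q.q x : ℂ)) *
        memoryState Q U ξ (fun i => S i ω) l i j) atTop (𝓝 0) := by
    simp only [ae_all_iff]
    exact fun x i j => by
      convert hS.ae_tendsto_setting_functional hU hξ x (Matrix.entryLinearMap ℂ ℂ i j)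
      rfl
  have h2 : ∀ᵐ ω ∂μ, ∀ x, Tendsto (fun n : ℕ => (n : ℂ)⁻¹ * ∑ l ∈ Finset.range n,
      ((if (S l ω).1 = x then 1 else 0) - (Q.q x : ℂ))) atTop (𝓝 0) := by
    rw [ae_all_iff]
    exact fun x => by convert hS.ae_tendsto_setting hU hξ x
  have h3 := ae_all_iff.2 (hS.ae_tendsto_event hU hξ)
  filter_upwards [h1, h2, h3, hS.ae_exists_average hU hξ] with ω h1 h2 h3 ⟨hst, ξbar, hbar, hlim⟩
  set e : ℕ → Σ x, K x := fun i => S i ω with he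
  set η := memoryState Q U ξ e with hη
  have hq : ∀ x, (Q.q x : ℂ) ≠ 0 := fun x => Complex.ofReal_ne_zero.2 (Q.q_pos x).ne'
  have hcount : ∀ x, Tendsto (fun n : ℕ => (n : ℂ)⁻¹ * (settingCount e x n : ℂ)) atTop
      (𝓝 (Q.q x : ℂ)) := by
    intro x
    have := (h2 x).add_const (Q.q x : ℂ)
    rw [zero_add] at this
    refine this.congr' ?_
    filter_upwards [eventually_ne_atTop 0] with n hn
    have hn' : (n : ℂ) ≠ 0 := Nat.cast_ne_zero.2 hn
    rw [settingCount_eq_sum, Finset.sum_sub_distrib, Finset.sum_const, Finset.card_range,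
      nsmul_eq_mul]
    field_simp
    ring
  -- The indicator of the setting is `q_x` plus a fluctuation; the fluctuation averages out by `h1`,
  -- and `q_x` multiplies the overall average.
  have hsetting : ∀ x, Tendsto (fun n : ℕ => (n : ℂ)⁻¹ • ∑ j ∈ runsWith e x n, η j) atTop
      (𝓝 ((Q.q x : ℂ) • ξbar)) := by
    intro x
    refine tendsto_pi_nhds.2 fun i => tendsto_pi_nhds.2 fun j => ?_
    have h4 := (tendsto_pi_nhds.1 (tendsto_pi_nhds.1 hlim i) j).const_mul (Q.q x : ℂ)
    have := (h1 x i j).add h4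
    rw [zero_add] at this
    refine this.congr fun n => ?_
    simp only [Matrix.smul_apply, Matrix.sum_apply, smul_eq_mul, sub_mul, Finset.sum_sub_distrib,
      runsWith, Finset.sum_filter, ite_mul, one_mul, zero_mul, ← Finset.mul_sum]
    rw [mul_left_comm, ← mul_add, sub_add_cancel]
    refine congrArg _ (Finset.sum_congr rfl fun l _ => ?_)
    by_cases h : (S l ω).1 = x
    · rw [if_pos h, if_pos (show (e l).1 = x from h)]
    · rw [if_neg h, if_neg (show ¬ (e l).1 = x from h), Matrix.zero_apply]
  have hprob : ∀ x k, ((instrument Q U ⟨x, k⟩ ξbar).trace.re : ℂ) =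
      (instrument Q U ⟨x, k⟩ ξbar).trace := fun x k => trace_instrument_re Q hbar.1 _
  have htable : IsTableOf Q (inducedMap U ξbar) fun x k => (instrument Q U ⟨x, k⟩ ξbar).trace.re :=
    fun x k => by
      rw [hprob, ← trace_interact_mul, ← trace_mul_traceMemory]
      rfl
  have hfreq : ∀ x k, Tendsto (fun n : ℕ => frequency e n x k) atTop
      (𝓝 (instrument Q U ⟨x, k⟩ ξbar).trace.re) := by
    intro x k
    set φ : Matrix M M ℂ →ₗ[ℂ] ℂ := Matrix.traceLinearMap M ℂ ℂ ∘ₗ instrumentMap Q U ⟨x, k⟩ with hφ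
    -- The Born weight is linear in the memory state, so its average converges to its value at the
    -- average state.
    have hφlim := ((φ.continuous_of_finiteDimensional.tendsto ξbar).comp hlim).const_mul
      (Q.q x : ℂ)
    have hev : Tendsto (fun n : ℕ => (n : ℂ)⁻¹ • (eventCount e x k n : ℂ)) atTop
        (𝓝 ((Q.q x : ℂ) • φ ξbar)) := by
      have := (h3 ⟨x, k⟩).add hφlim
      rw [zero_add] at this
      refine this.congr fun n => ?_
      have hφη : ∀ j, (instrument Q U ⟨x, k⟩ (η j)).trace = φ (η j) := fun _ => rfl
      simp only [Function.comp_apply, map_smul, map_sum, smul_eq_mul, Finset.sum_sub_distrib, hφη,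
        ← Finset.mul_sum, eventCount]
      rw [mul_left_comm (Q.q x : ℂ), ← mul_add, sub_add_cancel, Finset.sum_boole]
    have := (Complex.continuous_re.tendsto _).comp (tendsto_inv_smul_of_sub (hq x) (hcount x) hev)
    refine this.congr fun n => ?_
    rw [Function.comp_apply, smul_eq_mul, frequency, ← Complex.ofReal_natCast,
      ← Complex.ofReal_natCast, ← Complex.ofReal_inv, ← Complex.ofReal_mul, Complex.ofReal_re,
      div_eq_inv_mul]
  refine ⟨ξbar, hbar, hlim, fun x => tendsto_inv_smul_of_sub (hq x) (hcount x) (hsetting x),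
    fun x k => (instrument Q U ⟨x, k⟩ ξbar).trace.re, hfreq,
    fun x k => (hprob x k).trans (trace_interact_mul Q U ξbar x k).symm,
    isChannel_inducedMap hU hbar, htable, fun R hR => ?_⟩
  -- The limit `p` is exactly the table of a channel. Finite-run frequencies need not be, hence the
  -- use of continuity below.
  have hRp := hR _ (isChannel_inducedMap hU hbar) _ htable
  refine ⟨hRp, fun hcont σ => ?_⟩
  have := (hcont σ).tendsto.comp (tendsto_pi_nhds.2 fun x => tendsto_pi_nhds.2 fun k => hfreq x k)
  rw [hRp] at this
  exact this
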